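/- For a sequence of integers $n_0,n_1,n_2,\dots$ with $n_i\ge 2$, let $$\Sigma(n)=\Big\{(z_i)_{i\ge 0}\in\prod_{i\ge 0}\mathbb S^1 : z_{i+1}^{\,n_i}=z_i \text{ for all } i\ge 0\Big\}$$ be the inverse limit of unit circles $\mathbb S^1\subset\mathbb C$ under the covering maps $z\mapsto z^{n_i}$, with the subspace topology of the product. A solenoid is a topological space homeomorphic to $\Sigma(n)$ for some such sequence. A continuum is a nonempty compact connected (Hausdorff) space. A product $X\times Y$ of two continua has the fupcon property (full projections imply connected open neighbourhoods) if, for every subcontinuum $M\subseteq X\times Y$ with $\pi_X(M)=X$ and $\pi_Y(M)=Y$ and for every open set $U\supseteq M$, there is a connected open set $V$ with $M\subseteq V\subseteq U$. **Theorem 1.** Let $S$ be a solenoid. Then $[0,1]\times S$ has the fupcon property. -/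

import Mathlib

/-- A subset of a (Hausdorff) space is a *subcontinuum* if it is nonempty, compact and connected. -/
structure IsSubcontinuum {X : Type*} [TopologicalSpace X] (M : Set X) : Prop where
  isCompact : IsCompact M
  isConnected : IsConnected M

/-- `M` has arbitrarily small connected open neighbourhoods: every open `U ⊇ M` contains a
connected open `V ⊇ M`. -/
def HasSmallConnectedOpenNhds {X : Type*} [TopologicalSpace X] (M : Set X) : Prop :=
  ∀ U : Set X, IsOpen U → M ⊆ U → ∃ V : Set X, IsOpen V ∧ IsConnected V ∧ M ⊆ V ∧ V ⊆ U

/-- The product `X × Y` has the *fupcon* property (full projections imply connected open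
neighbourhoods): every subcontinuum of `X × Y` that projects onto both factors has arbitrarily
small connected open neighbourhoods. -/
def HasFupcon (X Y : Type*) [TopologicalSpace X] [TopologicalSpace Y] : Prop :=
  ∀ M : Set (X × Y), IsSubcontinuum M →
    Prod.fst '' M = Set.univ → Prod.snd '' M = Set.univ → HasSmallConnectedOpenNhds M

/-- The inverse limit of the sequence of unit circles `S₀ ← S₁ ← S₂ ← ⋯` whose `i`-th bonding map
is the covering map `z ↦ z ^ n i`, as a subspace of the product `∏ i, Sᵢ`. -/
def circleLimit (n : ℕ → ℕ) : Set (ℕ → Circle) :=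
  {x | ∀ i, x (i + 1) ^ n i = x i}

/-- A *solenoid* is a space homeomorphic to the inverse limit of unit circles under the covering
maps `z ↦ z ^ n i`, for some sequence of integers `n i ≥ 2`. -/
def IsSolenoid (S : Type*) [TopologicalSpace S] : Prop :=
  ∃ n : ℕ → ℕ, (∀ i, 2 ≤ n i) ∧ Nonempty (S ≃ₜ circleLimit n)

/-!
The solenoid `G = circleLimit n` is a compact abelian group. It contains a dense line `e : ℝ → G`,
and the kernel `K j` of the projection to the `j`-th circle is a compact subgroup; these subgroups
shrink to `1`, and `(s, k) ↦ e s * k` exhibits `G` as the quotient of `ℝ × K j` by the return times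
`ℤ * T j` of the line to `K j`. These facts are collected in `IsSolenoidalFlow`; they are all the
argument needs about `G`, and about `X = [0, 1]` it uses only local connectedness.

Let `M ⊆ X × G` be a continuum projecting onto `G` and `U` an open neighbourhood of it. By
compactness one may assume that `U` is invariant under some `K N`. Unroll `U` along the line to the
open set `W = {(x, s) | (x, e s) ∈ U} ⊆ X × ℝ`. The returns permute the components of `W`, so the
points `(x, e s * k)` with `(x, s)` in a fixed component `A` and `k ∈ K N` (`sweep e A (K N)`) form
a relatively clopen part of `U`, and for suitable `A` this part contains `M`
(`subset_sweep_connectedComponentIn`). There are two cases.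

* Some nonzero return maps `A` to itself. The closure of the group generated by this return is open
  in `K N`, because the returns are dense in `K N`. If `b` varies in a coset of this closure, the
  connected sets `sweep e A {b}` accumulate on each other, so together they form a connected open
  set. Hence `sweep e A (K N)` has open components, and the one containing `M` is the required
  neighbourhood (`isOpen_connectedComponentIn_sweep`).
* No return maps `A` to itself. Then `A × K N` is embedded in `X × G`, and by compactness and
  connectedness `M` lies over a bounded set of times and over a single coset of `K j`, for every
  `j`. As `T j → ∞`, such a set does not project onto `G`, a contradiction (`exists_return`).
-/

open Set Topology Filter

/-! ### Solenoidal flows and swept sets -/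

/-- A continuous one-parameter subgroup `e : ℝ → G` of a topological group together with a
decreasing sequence of compact subgroups `K j` shrinking to `1`, such that `(s, k) ↦ e s * k` is an
open surjection `ℝ × K j → G` whose kernel is the infinite cyclic group of the return times
`ℤ * T j` of `e` to `K j`. Every `G ⧸ K j` is then a circle of length `T j`, and these lengths tend
to infinity. Since `G` is commutative, `ℝ` acts on it by a flow which permutes the cosets of every
`K j`. -/
structure IsSolenoidalFlow {G : Type*} [CommGroup G] [TopologicalSpace G] (e : ℝ → G)
    (K : ℕ → Subgroup G) (T : ℕ → ℝ) : Prop where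
  continuous : Continuous e
  map_add : ∀ s t, e (s + t) = e s * e t
  antitone : Antitone K
  isCompact : ∀ j, IsCompact (K j : Set G)
  exists_subset : ∀ U ∈ 𝓝 (1 : G), ∃ j, (K j : Set G) ⊆ U
  isOpen_mul : ∀ j (J : Set ℝ), IsOpen J → IsOpen {g | ∃ s ∈ J, ∃ k ∈ K j, g = e s * k}
  exists_eq_mul : ∀ j g, ∃ s, ∃ k ∈ K j, g = e s * k
  mem_iff : ∀ j s, e s ∈ K j ↔ ∃ z : ℤ, s = z * T j
  tendsto : Tendsto T atTop atTop

/-- The part of `X × G` swept out by the points `b ∈ B` when `b` is moved along the flow `e` for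
the times prescribed by `O ⊆ X × ℝ`. -/
def sweep {X G : Type*} [Mul G] (e : ℝ → G) (O : Set (X × ℝ)) (B : Set G) : Set (X × G) :=
  {p | ∃ s, (p.1, s) ∈ O ∧ ∃ b ∈ B, p.2 = e s * b}

lemma sweep_mono {X G : Type*} [Mul G] {e : ℝ → G} {O O' : Set (X × ℝ)} {B B' : Set G}
    (hO : O ⊆ O') (hB : B ⊆ B') : sweep e O B ⊆ sweep e O' B' := by
  rintro p ⟨s, hs, b, hb, h⟩
  exact ⟨s, hO hs, b, hB hb, h⟩

lemma isPreconnected_sweep_singleton {X G : Type*} [TopologicalSpace X] [CommGroup G]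
    [TopologicalSpace G] [IsTopologicalGroup G] {e : ℝ → G} (he : Continuous e)
    {O : Set (X × ℝ)} (hO : IsPreconnected O) (b : G) : IsPreconnected (sweep e O {b}) := by
  have : sweep e O {b} = (fun p : X × ℝ => (p.1, e p.2 * b)) '' O := by
    ext ⟨x, g⟩
    constructor
    · rintro ⟨s, hs, _, rfl, h⟩
      exact ⟨(x, s), hs, Prod.ext rfl h.symm⟩
    · rintro ⟨⟨y, s⟩, hs, h⟩
      simp only [Prod.mk.injEq] at h
      obtain ⟨rfl, rfl⟩ := h
      exact ⟨s, hs, b, rfl, rfl⟩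
  rw [this]
  exact hO.image _ (by fun_prop)

/-! ### Return times, dense returns and saturated neighbourhoods -/

namespace IsSolenoidalFlow

variable {X G : Type*} [TopologicalSpace X] [CommGroup G] [TopologicalSpace G]
  {e : ℝ → G} {K : ℕ → Subgroup G} {T : ℕ → ℝ}

lemma map_zero (h : IsSolenoidalFlow e K T) : e 0 = 1 := by
  have := h.map_add 0 0
  simpa using this

lemma map_sub (h : IsSolenoidalFlow e K T) (s t : ℝ) : e (s - t) = e s / e t := by
  rw [eq_div_iff_mul_eq', ← h.map_add, sub_add_cancel]

lemma map_int_mul (h : IsSolenoidalFlow e K T) (z : ℤ) (t : ℝ) : e (z * t) = e t ^ z := by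
  let f : Multiplicative ℝ →* G :=
    { toFun := fun s => e s.toAdd, map_one' := h.map_zero, map_mul' := fun a b => h.map_add _ _ }
  have := map_zpow f (Multiplicative.ofAdd t) z
  rw [← ofAdd_zsmul, zsmul_eq_mul] at this
  exact this

/-- Two representations of the same point of `G` as a flow line through `K j` differ by a return
time. -/
lemma exists_sub_eq (h : IsSolenoidalFlow e K T) {j : ℕ} {s t : ℝ} {a b : G} (ha : a ∈ K j)
    (hb : b ∈ K j) (hab : e s * a = e t * b) : ∃ z : ℤ, t = s + z * T j := by
  have : e (t - s) ∈ K j := by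
    have h2 : e t / e s = a / b := by
      rw [div_eq_div_iff_mul_eq_mul, ← hab, mul_comm]
    rw [h.map_sub, h2]
    exact div_mem ha hb
  obtain ⟨z, hz⟩ := (h.mem_iff j _).1 this
  exact ⟨z, by linarith⟩

variable [IsTopologicalGroup G]

lemma isOpen_sweep (h : IsSolenoidalFlow e K T) {O : Set (X × ℝ)} (hO : IsOpen O) {B : Set G}
    (j : ℕ) (hB : ∀ b ∈ B, ∀ k ∈ K j, b * k ∈ B) : IsOpen (sweep e O B) := by
  rw [isOpen_iff_mem_nhds]
  rintro ⟨x, g⟩ ⟨s, hs, b, hb, rfl : g = _⟩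
  obtain ⟨I, J, hI, hJ, hxI, hsJ, hIJ⟩ := isOpen_prod_iff.1 hO x s hs
  have h2 : IsOpen ((fun g => g * b⁻¹) ⁻¹' {g | ∃ s ∈ J, ∃ k ∈ K j, g = e s * k}) :=
    (h.isOpen_mul j J hJ).preimage (by fun_prop)
  refine mem_of_superset ((hI.prod h2).mem_nhds ⟨hxI, ⟨s, hsJ, 1, one_mem _, by simp⟩⟩) ?_
  rintro ⟨y, g⟩ ⟨hy, t, ht, k, hk, hg⟩
  refine ⟨t, hIJ ⟨hy, ht⟩, b * k, hB b hb k hk, ?_⟩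
  simp only at hg ⊢
  rw [mul_inv_eq_iff_eq_mul.1 hg, mul_assoc, mul_comm k]

/-- The return times to `K N` trace out a dense subset of `K N`. -/
lemma subset_of_isClosed (h : IsSolenoidalFlow e K T) (N : ℕ) {C : Set G} (hC : IsClosed C)
    (hz : ∀ z : ℤ, e (z * T N) ∈ C) : (K N : Set G) ⊆ C := by
  intro k hk
  by_contra hkC
  have : (fun g => k * g) ⁻¹' Cᶜ ∈ 𝓝 (1 : G) :=
    (hC.isOpen_compl.preimage (by fun_prop)).mem_nhds (by simpa using hkC)
  obtain ⟨j, hj⟩ := h.exists_subset _ this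
  obtain ⟨s, l, hl, hs⟩ := h.exists_eq_mul (max j N) k
  have hl' := inv_mem hl
  have h1 : e s = k * l⁻¹ := by rw [hs]; group
  have h2 : e s ∈ K N := by
    rw [h1]; exact mul_mem hk (h.antitone (le_max_right _ _) hl')
  obtain ⟨z, hz'⟩ := (h.mem_iff _ _).1 h2
  have h3 : k * l⁻¹ ∈ Cᶜ := hj (h.antitone (le_max_left _ _) hl')
  rw [← h1, hz'] at h3
  exact h3 (hz z)

/-- The closure of the group generated by a nontrivial return of the flow to `K N` is open in
`K N`: finitely many of its translates cover the dense set of all returns. -/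
lemma exists_le_closure_zpowers (h : IsSolenoidalFlow e K T) (N : ℕ) {d : ℤ} (hd : d ≠ 0) :
    ∃ j, K j ≤ (Subgroup.zpowers (e (d * T N))).topologicalClosure := by
  set L := (Subgroup.zpowers (e (d * T N))).topologicalClosure
  have hLc : IsClosed (L : Set G) := Subgroup.isClosed_topologicalClosure _
  have hmem : ∀ z : ℤ, e (T N) ^ (d * z) ∈ L := fun z =>
    Subgroup.le_topologicalClosure _ ⟨z, by simp only [h.map_int_mul, zpow_mul]⟩
  have hcl : ∀ i : ℤ, IsClosed ((fun g => (e (T N) ^ i)⁻¹ * g) ⁻¹' (L : Set G)) := fun i =>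
    hLc.preimage (by fun_prop)
  -- every return lies in one of the translates of `L` by `0, …, |d| - 1` returns
  have hcov := h.subset_of_isClosed N
    (C := ⋃ i ∈ Ico (0 : ℤ) |d|, (fun g => (e (T N) ^ i)⁻¹ * g) ⁻¹' (L : Set G))
    ((finite_Ico _ _).isClosed_biUnion fun i _ => hcl i) (by
      intro z
      simp only [mem_iUnion, mem_preimage]
      refine ⟨z % d, ⟨Int.emod_nonneg z hd, Int.emod_lt_abs z hd⟩, ?_⟩
      have hexp : -(z % d) + z = d * (z / d) := by rw [Int.emod_def]; ring
      rw [h.map_int_mul, ← zpow_neg, ← zpow_add, hexp]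
      exact hmem (z / d))
  have hF : IsClosed (⋃ i ∈ {i ∈ Ico (0 : ℤ) |d| | e (T N) ^ i ∉ L},
      (fun g => (e (T N) ^ i)⁻¹ * g) ⁻¹' (L : Set G)) :=
    ((finite_Ico _ _).subset (sep_subset _ _)).isClosed_biUnion fun i _ => hcl i
  obtain ⟨j, hj⟩ := h.exists_subset _ (hF.isOpen_compl.mem_nhds (x := 1) (by
    simp only [mem_compl_iff, mem_iUnion, mem_preimage, not_exists]
    rintro i ⟨_, hi⟩ h1
    exact hi (by simpa using h1)))
  refine ⟨max j N, fun k hk => ?_⟩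
  have h1 := hcov (h.antitone (le_max_right _ _) hk)
  have h2 := hj (h.antitone (le_max_left _ _) hk)
  simp only [mem_compl_iff, mem_iUnion, mem_preimage, not_exists] at h1 h2
  obtain ⟨i, hi, hik⟩ := h1
  by_contra hkL
  refine h2 i ⟨hi, fun hiL => hkL ?_⟩ hik
  simpa using mul_mem hiL hik

/-- A compact set in an open subset `U` of `X × G` lies in an open subset of `U` that is saturated
for the action of some `K N` on the second factor. -/
lemma exists_saturated_open (h : IsSolenoidalFlow e K T) {M U : Set (X × G)} (hM : IsCompact M)
    (hU : IsOpen U) (hMU : M ⊆ U) :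
    ∃ N, ∃ U' : Set (X × G), IsOpen U' ∧ M ⊆ U' ∧ U' ⊆ U ∧
      ∀ x g, (x, g) ∈ U' → ∀ k ∈ K N, (x, g * k) ∈ U' := by
  let U' : ℕ → Set (X × G) := fun N => {p | ∀ k ∈ (K N : Set G), (p.1, p.2 * k) ∈ U}
  have hopen : ∀ N, IsOpen (U' N) := fun N => by
    rw [isOpen_iff_mem_nhds]
    intro p hp
    refine (h.isCompact N).eventually_forall_of_forall_eventually fun k hk => ?_
    have : IsOpen ((fun q : (X × G) × G => (q.1.1, q.1.2 * q.2)) ⁻¹' U) :=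
      hU.preimage (by fun_prop)
    exact this.mem_nhds (hp k hk)
  have hmono : Monotone U' := fun a b hab p hp k hk => hp k (h.antitone hab hk)
  obtain ⟨N, hN⟩ := hM.elim_directed_cover U' hopen (fun p hp => by
    have : (fun g => (p.1, p.2 * g)) ⁻¹' U ∈ 𝓝 (1 : G) :=
      (hU.preimage (by fun_prop)).mem_nhds (by simpa using hMU hp)
    obtain ⟨j, hj⟩ := h.exists_subset _ this
    exact mem_iUnion.2 ⟨j, fun k hk => hj hk⟩) hmono.directed_le
  refine ⟨N, U' N, hopen N, hN, fun p hp => by simpa using hp 1 (one_mem _), ?_⟩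
  intro x g hg k hk l hl
  simpa [mul_assoc] using hg (k * l) (mul_mem hk hl)

end IsSolenoidalFlow

/-- The components of a set in `X × ℝ` that is invariant under a translation of the second
coordinate are permuted by this translation. -/
lemma mem_connectedComponentIn_translate {X : Type*} [TopologicalSpace X] {W : Set (X × ℝ)} {c : ℝ}
    (hW : ∀ x s, (x, s) ∈ W → (x, s + c) ∈ W) {a p : X × ℝ}
    (hp : p ∈ connectedComponentIn W a) :
    (p.1, p.2 + c) ∈ connectedComponentIn W (a.1, a.2 + c) := by
  have ha : a ∈ W := connectedComponentIn_nonempty_iff.1 ⟨p, hp⟩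
  have hc : Continuous fun q : X × ℝ => (q.1, q.2 + c) := by fun_prop
  exact connectedComponentIn_mono _ (image_subset_iff.2 fun q hq => hW _ _ hq)
    (hc.continuousOn.image_connectedComponentIn_subset ha (mem_image_of_mem _ hp))

/-! ### Neighbourhoods of continua in products with a solenoidal flow -/

namespace IsSolenoidalFlow

variable {X G : Type*} [TopologicalSpace X] [CommGroup G] [TopologicalSpace G]
  [IsTopologicalGroup G] {e : ℝ → G} {K : ℕ → Subgroup G} {T : ℕ → ℝ}

/-- In a saturated open set `U`, the part swept out by one component of the unrolled set
`{(x, s) | (x, e s) ∈ U}` is relatively clopen, since the components are permuted by the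
returns. -/
lemma subset_sweep_connectedComponentIn [LocallyConnectedSpace X] (h : IsSolenoidalFlow e K T)
    {N : ℕ} {M U : Set (X × G)} (hM : IsPreconnected M) (hU : IsOpen U) (hMU : M ⊆ U)
    (hsat : ∀ x g, (x, g) ∈ U → ∀ k ∈ K N, (x, g * k) ∈ U) (a : X × ℝ)
    (hne : (M ∩ sweep e (connectedComponentIn {p : X × ℝ | (p.1, e p.2) ∈ U} a) (K N)).Nonempty) :
    M ⊆ sweep e (connectedComponentIn {p : X × ℝ | (p.1, e p.2) ∈ U} a) (K N) := by
  set W : Set (X × ℝ) := {p | (p.1, e p.2) ∈ U}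
  have he := h.continuous
  have hWo : IsOpen W := hU.preimage (f := fun p : X × ℝ => (p.1, e p.2)) (by fun_prop)
  have hWinv : ∀ z : ℤ, ∀ x s, (x, s) ∈ W → (x, s + z * T N) ∈ W := fun z x s hs => by
    have := hsat _ _ hs (e (z * T N)) ((h.mem_iff _ _).2 ⟨z, rfl⟩)
    rwa [← h.map_add] at this
  have hopen : ∀ w, IsOpen (sweep e (connectedComponentIn W w) (K N : Set G)) := fun w =>
    h.isOpen_sweep hWo.connectedComponentIn N fun b hb k hk => mul_mem hb hk
  -- overlapping swept sets of components coincide, as the components are translates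
  have hov : ∀ w, ¬ Disjoint (sweep e (connectedComponentIn W a) (K N : Set G))
      (sweep e (connectedComponentIn W w) (K N)) →
      sweep e (connectedComponentIn W w) (K N : Set G) ⊆
        sweep e (connectedComponentIn W a) (K N) := by
    intro w hw
    obtain ⟨⟨x, g⟩, ⟨s, hs, b, hb, hg⟩, ⟨s', hs', b', hb', hg'⟩⟩ := not_disjoint_iff.1 hw
    simp only at hg hg' hs hs'
    obtain ⟨z, hz⟩ := h.exists_sub_eq hb' hb (hg'.symm.trans hg)
    rintro ⟨y, g₂⟩ ⟨t, ht, c, hc, hg₂⟩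
    simp only at ht hg₂
    rw [connectedComponentIn_eq hs'] at ht
    have h1 := mem_connectedComponentIn_translate (hWinv z) ht
    rw [← hz, ← connectedComponentIn_eq hs] at h1
    refine ⟨_, h1, e (-(z * T N)) * c, mul_mem ((h.mem_iff _ _).2 ⟨-z, by simp⟩) hc, ?_⟩
    rw [← mul_assoc, ← h.map_add, hg₂, add_neg_cancel_right]
  refine hM.subset_left_of_subset_union (hopen a)
    (v := ⋃ w ∈ {w | Disjoint (sweep e (connectedComponentIn W a) (K N : Set G))
      (sweep e (connectedComponentIn W w) (K N))}, sweep e (connectedComponentIn W w) (K N))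
    (isOpen_biUnion fun w _ => hopen w) (disjoint_iUnion₂_right.2 fun w hw => hw) ?_ hne
  rintro ⟨x, g⟩ hp
  obtain ⟨s, k, hk, hg⟩ := h.exists_eq_mul N g
  have hs : (x, s) ∈ W := by
    have := hsat _ _ (hMU hp) _ (inv_mem hk)
    rwa [hg, mul_inv_cancel_right] at this
  have hmem : (x, g) ∈ sweep e (connectedComponentIn W (x, s)) (K N : Set G) :=
    ⟨s, mem_connectedComponentIn hs, k, hk, hg⟩
  by_cases hd : Disjoint (sweep e (connectedComponentIn W a) (K N : Set G))
      (sweep e (connectedComponentIn W (x, s)) (K N))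
  · exact Or.inr (mem_biUnion (x := (x, s)) hd hmem)
  · exact Or.inl (hov _ hd hmem)

/-- If no point of `O` returns to `O`, then `O × K N` is embedded in `X × G`, and the cosets of
`K j` in `K N` cut its image into pieces which are relatively clopen. -/
lemma subset_sweep_coset (h : IsSolenoidalFlow e K T) {N j : ℕ} (hNj : N ≤ j) {O : Set (X × ℝ)}
    (hO : IsOpen O) (hret : ∀ x s, ∀ z : ℤ, (x, s) ∈ O → (x, s + z * T N) ∈ O → z = 0)
    {M : Set (X × G)} (hM : IsPreconnected M) (hMO : M ⊆ sweep e O (K N)) {b : G} (hb : b ∈ K N)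
    (hne : (M ∩ sweep e O {g | b⁻¹ * g ∈ K j}).Nonempty) :
    M ⊆ sweep e O {g | b⁻¹ * g ∈ K j} := by
  refine hM.subset_left_of_subset_union (v := sweep e O {g | g ∈ K N ∧ b⁻¹ * g ∉ K j})
    (h.isOpen_sweep hO j ?_) (h.isOpen_sweep hO j ?_) ?_ ?_ hne
  · intro g hg k hk
    simpa [mul_assoc] using mul_mem hg hk
  · rintro g ⟨hg, hg'⟩ k hk
    refine ⟨mul_mem hg (h.antitone hNj hk), fun hgk => hg' ?_⟩
    simpa [mul_assoc] using mul_mem hgk (inv_mem hk)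
  · rw [Set.disjoint_left]
    rintro ⟨x, g⟩ ⟨s, hs, k, hk, hg⟩ ⟨t, ht, l, ⟨hl, hl'⟩, hg'⟩
    simp only at hs ht hg hg'
    have hk' : k ∈ K N := by simpa using mul_mem hb (h.antitone hNj hk)
    obtain ⟨z, rfl⟩ := h.exists_sub_eq hk' hl (hg.symm.trans hg')
    obtain rfl := hret _ _ _ hs ht
    simp only [Int.cast_zero, zero_mul, add_zero] at hg'
    rw [mul_left_cancel (hg.symm.trans hg')] at hk
    exact hl' hk
  · intro p hp
    obtain ⟨s, hs, k, hk, hg⟩ := hMO hp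
    by_cases hkj : b⁻¹ * k ∈ K j
    · exact Or.inl ⟨s, hs, k, hkj, hg⟩
    · exact Or.inr ⟨s, hs, k, ⟨hk, hkj⟩, hg⟩

/-- A continuum projecting onto `G` forces returns: otherwise it would lie over a bounded time
interval and, for every `j`, over a single coset of `K j`, so that bounded times would suffice to
go round the circle `G ⧸ K j` of length `T j`. -/
lemma exists_return (h : IsSolenoidalFlow e K T) {N : ℕ} {O : Set (X × ℝ)} (hO : IsOpen O)
    {M : Set (X × G)} (hM : IsSubcontinuum M) (hsurj : Prod.snd '' M = univ)
    (hMO : M ⊆ sweep e O (K N)) :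
    ∃ x s, ∃ z : ℤ, z ≠ 0 ∧ (x, s) ∈ O ∧ (x, s + z * T N) ∈ O := by
  by_contra! hcon
  have hret : ∀ x s, ∀ z : ℤ, (x, s) ∈ O → (x, s + z * T N) ∈ O → z = 0 := fun x s z h1 h2 => by
    by_contra hz
    exact hcon x s z hz h1 h2
  have hbdd : ∀ R : ℕ, IsOpen (O ∩ {p | |p.2| < R}) := fun R =>
    hO.inter (isOpen_lt (by fun_prop) continuous_const)
  obtain ⟨R, hR⟩ := hM.isCompact.elim_directed_cover
    (fun R : ℕ => sweep e (O ∩ {p | |p.2| < R}) (K N : Set G))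
    (fun R => h.isOpen_sweep (hbdd R) N fun b hb k hk => mul_mem hb hk)
    (fun p hp => by
      obtain ⟨s, hs, k, hk, hg⟩ := hMO hp
      obtain ⟨R, hR⟩ := exists_nat_gt |s|
      exact mem_iUnion.2 ⟨R, s, ⟨hs, hR⟩, k, hk, hg⟩)
    (Monotone.directed_le fun a b hab => sweep_mono (fun p hp => ⟨hp.1,
      lt_of_lt_of_le (show |p.2| < a from hp.2) (by exact_mod_cast hab)⟩) subset_rfl)
  obtain ⟨j, hTj, hNj⟩ := ((h.tendsto.eventually_gt_atTop (2 * R : ℝ)).and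
    (eventually_ge_atTop N)).exists
  obtain ⟨p, hp⟩ := hM.isConnected.nonempty
  obtain ⟨s₀, hs₀, b, hb, hg₀⟩ := hMO hp
  have hcoset := h.subset_sweep_coset hNj hO hret hM.isConnected.isPreconnected hMO hb
    ⟨p, hp, s₀, hs₀, b, by simp, hg₀⟩
  -- the time from `b` to this point modulo `K j` is `R` up to multiples of `T j > 2 * R`
  obtain ⟨⟨x, g⟩, hq, hgR : g = e R * b⟩ : e R * b ∈ Prod.snd '' M := hsurj ▸ mem_univ _
  obtain ⟨s, ⟨hs, hsR : |s| < R⟩, k, hk, hg : g = e s * k⟩ := hR hq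
  obtain ⟨t, ht, l, hl, hg' : g = e t * l⟩ := hcoset hq
  have hlN : l ∈ K N := by simpa using mul_mem hb (h.antitone hNj hl)
  obtain ⟨z, rfl⟩ := h.exists_sub_eq hk hlN (hg.symm.trans hg')
  obtain rfl := hret _ _ _ hs ht
  simp only [Int.cast_zero, zero_mul, add_zero] at hg'
  have hmem : e (R - s) ∈ K j := by
    have : e (R - s) = b⁻¹ * l := by
      rw [h.map_sub, div_eq_iff_eq_mul, eq_comm, mul_comm, ← mul_assoc, mul_comm _ b⁻¹, mul_assoc,
        ← hg', hgR, mul_comm (e _), inv_mul_cancel_left]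
    rw [this]; exact hl
  obtain ⟨z, hz⟩ := (h.mem_iff _ _).1 hmem
  rw [abs_lt] at hsR
  have hT : 0 < T j := lt_of_le_of_lt (by positivity) hTj
  have h1 : (0 : ℝ) < z * T j := by linarith
  have h2 : (0 : ℝ) < z := pos_of_mul_pos_left h1 hT.le
  have h3 : (1 : ℝ) ≤ z := by exact_mod_cast h2
  nlinarith

/-- If some point of the component `A` of `W` returns to `A`, then `A` is invariant under that
return, so `sweep e A {b}` is dense in the sweep of the open coset of `b` modulo the closure of the
group generated by the return, and the latter is therefore connected. -/
lemma isOpen_connectedComponentIn_sweep [T2Space G] (h : IsSolenoidalFlow e K T) {N : ℕ}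
    {W : Set (X × ℝ)} {a : X × ℝ} (hA : IsOpen (connectedComponentIn W a))
    (hW : ∀ z : ℤ, ∀ x s, (x, s) ∈ W → (x, s + z * T N) ∈ W)
    {x : X} {s : ℝ} {d : ℤ} (hd : d ≠ 0) (hs : (x, s) ∈ connectedComponentIn W a)
    (hsd : (x, s + d * T N) ∈ connectedComponentIn W a) (p : X × G) :
    IsOpen (connectedComponentIn (sweep e (connectedComponentIn W a) (K N)) p) := by
  set A := connectedComponentIn W a
  have hstep : ∀ c : ℤ, (x, s + c * T N) ∈ A → ∀ y t, (y, t) ∈ A → (y, t + c * T N) ∈ A := by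
    intro c hc y t ht
    have ht' : (y, t) ∈ connectedComponentIn W (x, s) := by rwa [← connectedComponentIn_eq hs]
    have := mem_connectedComponentIn_translate (hW c) ht'
    rwa [← connectedComponentIn_eq hc] at this
  have hneg : (x, s + (-d : ℤ) * T N) ∈ A := by
    have hs' : (x, s) ∈ connectedComponentIn W (x, s + d * T N) := by
      rwa [← connectedComponentIn_eq hsd]
    have := mem_connectedComponentIn_translate (hW (-d)) hs'
    rwa [show s + d * T N + (-d : ℤ) * T N = s by push_cast; ring,
      ← connectedComponentIn_eq hs] at this
  have hinv : ∀ z : ℤ, ∀ y t, (y, t) ∈ A → (y, t + z * (d * T N)) ∈ A := by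
    intro z
    induction z with
    | zero => simp
    | succ i ih =>
      intro y t ht
      have := hstep d hsd _ _ (ih y t ht)
      convert this using 2
      push_cast; ring
    | pred i ih =>
      intro y t ht
      have := hstep (-d) hneg _ _ (ih y t ht)
      convert this using 2
      push_cast; ring
  set L := (Subgroup.zpowers (e (d * T N))).topologicalClosure
  obtain ⟨j, hj⟩ := h.exists_le_closure_zpowers N hd
  have hLK : L ≤ K N := Subgroup.topologicalClosure_minimal _
    (Subgroup.zpowers_le.2 ((h.mem_iff _ _).2 ⟨d, rfl⟩)) (h.isCompact N).isClosed
  have hpre : ∀ b, IsPreconnected (sweep e A {g | b⁻¹ * g ∈ L}) := by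
    intro b
    refine (isPreconnected_sweep_singleton h.continuous isPreconnected_connectedComponentIn
      b).subset_closure (sweep_mono subset_rfl (by simp)) ?_
    rintro ⟨y, g⟩ ⟨t, ht, k, hk, rfl : g = _⟩
    have hk' : b⁻¹ * k ∈ closure (Subgroup.zpowers (e (d * T N)) : Set G) := hk
    have hc : Continuous fun l : G => (y, e t * (b * l)) := by fun_prop
    have := map_mem_closure hc hk' (t := sweep e A {b}) (by
      rintro _ ⟨z, rfl⟩
      refine ⟨_, hinv z _ _ ht, b, rfl, ?_⟩
      simp only [h.map_add, h.map_int_mul z]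
      rw [mul_comm b, mul_assoc])
    simpa using this
  rw [isOpen_iff_mem_nhds]
  intro q hq
  rw [connectedComponentIn_eq hq]
  have hqs := connectedComponentIn_subset _ _ hq
  obtain ⟨t, ht, b, hb, hqb⟩ := hqs
  have hqV : q ∈ sweep e A {g | b⁻¹ * g ∈ L} := ⟨t, ht, b, by simp, hqb⟩
  refine mem_of_superset ((h.isOpen_sweep hA j fun g hg k hk => ?_).mem_nhds hqV)
    ((hpre b).subset_connectedComponentIn hqV (sweep_mono subset_rfl fun g hg => ?_))
  · simpa [mul_assoc] using mul_mem hg (hj hk)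
  · simpa using mul_mem hb (hLK hg)

theorem hasSmallConnectedOpenNhds [LocallyConnectedSpace X] [T2Space G]
    (h : IsSolenoidalFlow e K T) {M : Set (X × G)} (hM : IsSubcontinuum M)
    (hsurj : Prod.snd '' M = univ) : HasSmallConnectedOpenNhds M := by
  intro U hU hMU
  obtain ⟨N, U', hU', hMU', hU'U, hsat⟩ := h.exists_saturated_open hM.isCompact hU hMU
  obtain ⟨⟨x₀, g₀⟩, hp₀⟩ := hM.isConnected.nonempty
  obtain ⟨s₀, k₀, hk₀, hg₀⟩ := h.exists_eq_mul N g₀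
  have he := h.continuous
  have hWo : IsOpen {p : X × ℝ | (p.1, e p.2) ∈ U'} :=
    hU'.preimage (f := fun p : X × ℝ => (p.1, e p.2)) (by fun_prop)
  have hWinv : ∀ z : ℤ, ∀ x s, (x, s) ∈ {p : X × ℝ | (p.1, e p.2) ∈ U'} →
      (x, s + z * T N) ∈ {p : X × ℝ | (p.1, e p.2) ∈ U'} := fun z x s hs => by
    have := hsat _ _ hs (e (z * T N)) ((h.mem_iff _ _).2 ⟨z, rfl⟩)
    rwa [← h.map_add] at this
  have hs₀ : (x₀, s₀) ∈ {p : X × ℝ | (p.1, e p.2) ∈ U'} := by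
    have := hsat _ _ (hMU' hp₀) _ (inv_mem hk₀)
    rwa [hg₀, mul_inv_cancel_right] at this
  have hMA := h.subset_sweep_connectedComponentIn hM.isConnected.isPreconnected hU' hMU' hsat
    (x₀, s₀) ⟨_, hp₀, s₀, mem_connectedComponentIn hs₀, k₀, hk₀, hg₀⟩
  obtain ⟨x, s, d, hd, hs, hsd⟩ := h.exists_return hWo.connectedComponentIn hM hsurj hMA
  refine ⟨_, h.isOpen_connectedComponentIn_sweep hWo.connectedComponentIn hWinv hd hs hsd
    (x₀, g₀), isConnected_connectedComponentIn_iff.2 (hMA hp₀),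
    hM.isConnected.isPreconnected.subset_connectedComponentIn hp₀ hMA,
    (connectedComponentIn_subset _ _).trans (Subset.trans ?_ hU'U)⟩
  rintro ⟨y, g⟩ ⟨t, ht, k, hk, hg⟩
  have ht' := connectedComponentIn_subset _ _ ht
  have := hsat y (e t) ht' k hk
  rwa [← show g = e t * k from hg] at this

end IsSolenoidalFlow

/-! ### Invariance under homeomorphisms, and the interval -/

lemma HasSmallConnectedOpenNhds.of_image {X Y : Type*} [TopologicalSpace X] [TopologicalSpace Y]
    (f : X ≃ₜ Y) {M : Set X} (h : HasSmallConnectedOpenNhds (f '' M)) :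
    HasSmallConnectedOpenNhds M := by
  intro U hU hMU
  obtain ⟨V, hV, hVc, hMV, hVU⟩ := h (f '' U) (f.isOpenMap U hU) (image_mono hMU)
  refine ⟨f ⁻¹' V, hV.preimage f.continuous, ?_, image_subset_iff.1 hMV, ?_⟩
  · rw [← f.image_symm]
    exact hVc.image _ f.symm.continuous.continuousOn
  · rw [← f.preimage_image U]
    exact preimage_mono hVU

lemma locallyConnectedSpace_unitInterval : LocallyConnectedSpace unitInterval :=
  (isQuotientMap_projIcc (h := zero_le_one' ℝ)).isCoinducing.locallyConnectedSpace

/-! ### The flow on the inverse limit of circles -/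

namespace circleLimit

open Real

variable (n : ℕ → ℕ)

/-- The inverse limit of circles as a subgroup of the product of circles. -/
noncomputable def subgroup : Subgroup (ℕ → Circle) where
  carrier := circleLimit n
  one_mem' i := one_pow _
  mul_mem' {x y} hx hy i := by
    rw [Pi.mul_apply, Pi.mul_apply, mul_pow, hx i, hy i]
  inv_mem' {x} hx i := by
    rw [Pi.inv_apply, Pi.inv_apply, inv_pow, hx i]

/-- The degree of the projection of the `j`-th circle to the circle `0`. -/
def degree (j : ℕ) : ℕ := ∏ i ∈ Finset.range j, n i

/-- The subgroup of the points whose `j`-th coordinate is `1`. -/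
noncomputable def fibre (j : ℕ) : Subgroup (subgroup n) :=
  ((Pi.evalMonoidHom (fun _ : ℕ => Circle) j).comp (subgroup n).subtype).ker

variable {n}

lemma continuous_coord (j : ℕ) : Continuous fun x : subgroup n => x.1 j :=
  (continuous_apply j).comp continuous_subtype_val

lemma mem_fibre {j : ℕ} {x : subgroup n} : x ∈ fibre n j ↔ x.1 j = 1 := Iff.rfl

lemma two_pow_le_degree (hn : ∀ i, 2 ≤ n i) (j : ℕ) : 2 ^ j ≤ degree n j := by
  simpa [degree] using Finset.prod_le_prod' (s := Finset.range j) fun i _ => hn i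

lemma degree_pos (hn : ∀ i, 2 ≤ n i) (j : ℕ) : (0 : ℝ) < degree n j := by
  exact_mod_cast (Nat.two_pow_pos j).trans_le (two_pow_le_degree hn j)

/-- The one-parameter subgroup of the inverse limit which lifts the standard parametrization of
the circle `0`. -/
noncomputable def leaf (hn : ∀ i, 2 ≤ n i) (s : ℝ) : subgroup n :=
  ⟨fun i => Circle.exp (s / degree n i), fun i => by
    have h0 : (n i : ℝ) ≠ 0 := by
      have := hn i
      positivity
    have h1 := (degree_pos hn i).ne'
    have h2 : (degree n (i + 1) : ℝ) = degree n i * n i := by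
      simp [degree, Finset.prod_range_succ]
    rw [← Circle.exp_nsmul, nsmul_eq_mul, h2]
    congr 1
    field_simp⟩

lemma fibre_antitone : Antitone (fibre n) := by
  refine antitone_nat_of_succ_le fun j x hx => ?_
  rw [mem_fibre] at hx ⊢
  rw [← x.2 j, hx, one_pow]

lemma isClosed_fibre (j : ℕ) : IsClosed (fibre n j : Set (subgroup n)) :=
  isClosed_eq (continuous_coord j) continuous_const

lemma isClosed_circleLimit : IsClosed (circleLimit n) := by
  have : circleLimit n = ⋂ i, {x : ℕ → Circle | x (i + 1) ^ n i = x i} := by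
    ext x; simp [circleLimit]
  rw [this]
  exact isClosed_iInter fun i => isClosed_eq (by fun_prop) (by fun_prop)

instance : CompactSpace (subgroup n) :=
  isCompact_iff_compactSpace.1 (isClosed_circleLimit (n := n)).isCompact

lemma exists_fibre_subset {U : Set (subgroup n)} (hU : U ∈ 𝓝 1) :
    ∃ j, (fibre n j : Set (subgroup n)) ⊆ U := by
  -- the fibres are decreasing compact sets with intersection `{1}`
  obtain ⟨V, hVU, hV, h1⟩ := mem_nhds_iff.1 hU
  obtain ⟨j, hj⟩ := exists_subset_nhds_of_isCompact'
    (V := fun j => (fibre n j : Set (subgroup n)))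
    (directed_of_isDirected_le fun i j hij => fibre_antitone hij)
    (fun j => (isClosed_fibre j).isCompact) isClosed_fibre (U := V) (fun x hx => by
      have : x = 1 := Subtype.ext (funext fun j => mem_iInter.1 hx j)
      exact this ▸ hV.mem_nhds h1)
  exact ⟨j, hj.trans hVU⟩

lemma exists_eq_leaf_mul_iff (hn : ∀ i, 2 ≤ n i) {j : ℕ} {s : ℝ} {g : subgroup n} :
    (∃ k ∈ fibre n j, g = leaf hn s * k) ↔ g.1 j = Circle.exp (s / degree n j) := by
  constructor
  · rintro ⟨k, hk, rfl⟩
    change Circle.exp _ * k.1 j = _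
    rw [mem_fibre.1 hk, mul_one]
  · intro h
    refine ⟨(leaf hn s)⁻¹ * g, ?_, by simp⟩
    change (Circle.exp _)⁻¹ * g.1 j = 1
    rw [h, inv_mul_cancel]

/-- A solenoid carries a solenoidal flow, for which `G ⧸ K j` is the `j`-th circle. -/
lemma isSolenoidalFlow (hn : ∀ i, 2 ≤ n i) :
    IsSolenoidalFlow (leaf hn) (fibre n) fun j => 2 * π * degree n j where
  continuous := Continuous.subtype_mk (continuous_pi fun i => by fun_prop) _
  map_add s t := Subtype.ext <| funext fun i => by
    change Circle.exp _ = Circle.exp _ * Circle.exp _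
    rw [add_div, Circle.exp_add]
  antitone := fibre_antitone
  isCompact j := (isClosed_fibre j).isCompact
  exists_subset _ hU := exists_fibre_subset hU
  isOpen_mul j J hJ := by
    simp only [exists_eq_leaf_mul_iff hn]
    have hd := (degree_pos hn j).ne'
    have h1 : IsOpen ((fun s : ℝ => s * degree n j) ⁻¹' J) := hJ.preimage (by fun_prop)
    have h2 := isLocalHomeomorph_circleExp.isOpenMap _ h1
    convert h2.preimage (continuous_coord j) using 1
    ext g
    constructor
    · rintro ⟨s, hs, hg⟩
      exact ⟨s / degree n j, by simpa [hd] using hs, hg.symm⟩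
    · rintro ⟨s, hs, hg⟩
      exact ⟨s * degree n j, hs, by simpa [hd] using hg.symm⟩
  exists_eq_mul j g := by
    simp only [exists_eq_leaf_mul_iff hn]
    obtain ⟨s, hs⟩ := Circle.exp_surjective (g.1 j)
    exact ⟨s * degree n j, by simp [(degree_pos hn j).ne', hs]⟩
  mem_iff j s := by
    rw [mem_fibre]
    change Circle.exp _ = 1 ↔ _
    rw [Circle.exp_eq_one]
    simp only [div_eq_iff (degree_pos hn j).ne', mul_assoc]
  tendsto := by
    refine Tendsto.const_mul_atTop two_pi_pos (tendsto_natCast_atTop_atTop.comp ?_)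
    exact tendsto_atTop_mono (two_pow_le_degree hn) (tendsto_pow_atTop_atTop_of_one_lt one_lt_two)

end circleLimit

/-! ### The product of the interval and a solenoid -/

theorem theorem1 {S : Type*} [TopologicalSpace S] (hS : IsSolenoid S) :
    HasFupcon unitInterval S := by
  obtain ⟨n, hn, ⟨f⟩⟩ := hS
  intro M hM _ hsurj
  have := locallyConnectedSpace_unitInterval
  let F : unitInterval × S ≃ₜ unitInterval × circleLimit.subgroup n :=
    (Homeomorph.refl _).prodCongr f
  refine .of_image F ((circleLimit.isSolenoidalFlow hn).hasSmallConnectedOpenNhds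
    ⟨hM.isCompact.image F.continuous, hM.isConnected.image _ F.continuous.continuousOn⟩ ?_)
  have : Prod.snd '' (F '' M) = f '' (Prod.snd '' M) := by
    simp only [image_image]
    rfl
  rw [this, hsurj, image_univ, f.range_coe]
  rfl
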